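/- Let $a=2\cos\frac{2\pi}{5}$, $b=2\cos\frac{\pi}{5}$, $f(\xi)=\xi^8(\xi-a)^3(\xi-b)^9$, let $S=\{(\xi,\eta)\in\mathbb{C}^2 : \eta^{10}=f(\xi)\}$ and $S_{\mathrm{reg}}=S\setminus\{(0,0),(a,0),(b,0)\}$. Let $k=a\big/\int_0^a \frac{d\xi}{f(\xi)^{1/10}}>0$ (positive tenth root on $(0,a)$). On $S_{\mathrm{reg}}$ consider the holomorphic vector field $X=\frac{1}{k}\,\eta\,\frac{\partial}{\partial\xi}+\frac{1}{10k}\frac{f'(\xi)}{\eta^8}\frac{\partial}{\partial\eta}$ and the Riemannian metric $\Gamma=\frac{k}{\eta}d\xi\odot\overline{\frac{k}{\eta}d\xi}$, that is, $\Gamma(v,w)=\mathrm{Re}\big(\tfrac{k}{\eta}d\xi(v)\,\overline{\tfrac{k}{\eta}d\xi(w)}\big)$. (i) Every point of $S_{\mathrm{reg}}$ has an open neighbourhood in $S_{\mathrm{reg}}$ on which there is a branch $\delta(\xi,\eta)=F(\xi)$ of $\int k\,\frac{d\xi}{\eta}$ that maps the neighbourhood biholomorphically onto an open subset of $\mathbb{C}$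 and straightens $X$: $T\delta(X)=\frac{\partial}{\partial z}$. (ii) Let $\mu:J\to S_{\mathrm{reg}}$ be a real time integral curve of $X$ on a nonempty open interval $J\subseteq\mathbb{R}$, and let $\varphi:D\to S_{\mathrm{reg}}$, with $D\subseteq\mathbb{C}$ open and connected and $J\subseteq D$, be a complex time integral curve of $X$ (that is, $\varphi$ is holomorphic with $\varphi'(z)=X(\varphi(z))$) such that $\varphi|_J=\mu$. Let $\alpha\in\mathbb{C}\setminus\{0\}$, $z_0\in\mathbb{C}$, and let $I\subseteq\mathbb{R}$ be a nonempty open interval such that $z_0+\alpha t\in D$ for all $t\in I$. Then the complex time reparametrization $\sigma:I\to S_{\mathrm{reg}}$, $\sigma(t)=\varphi(z_0+\alpha t)$, of $\mu$ is a geodesic of the Riemannian manifold $(S_{\mathrm{reg}},\Gamma)$. -/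

import Mathlib

open scoped ContDiff ComplexConjugate

noncomputable section

namespace Icosahedron

/-! ### Riemannian geodesics on an embedded submanifold, in local charts -/

/-- A smooth chart of an embedded `n`-dimensional submanifold `M` of a real normed space `E`: a
homeomorphism of an open subset of `M` onto an open subset of `ℝⁿ` whose inverse is a smooth
immersion into `E`. -/
structure IsSmoothChart {E : Type*} [NormedAddCommGroup E] [NormedSpace ℝ E] {M : Set E} {n : ℕ}
    (χ : OpenPartialHomeomorph M (Fin n → ℝ)) : Prop where
  smooth : ContDiffOn ℝ ∞ (fun u => (χ.symm u : E)) χ.target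
  immersion : ∀ u ∈ χ.target, Function.Injective (fderiv ℝ (fun u => (χ.symm u : E)) u)

/-- The coefficient matrix `g_{ij} = Γ(∂ᵢ, ∂ⱼ)` of the metric `Γ` in the chart `χ`. -/
def metricInChart {E : Type*} [NormedAddCommGroup E] [NormedSpace ℝ E] {M : Set E} {n : ℕ}
    (Γ : M → E → E → ℝ) (χ : OpenPartialHomeomorph M (Fin n → ℝ)) (u : Fin n → ℝ) :
    Matrix (Fin n) (Fin n) ℝ :=
  Matrix.of fun i j =>
    Γ (χ.symm u) (fderiv ℝ (fun u => (χ.symm u : E)) u (Pi.single i 1))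
      (fderiv ℝ (fun u => (χ.symm u : E)) u (Pi.single j 1))

/-- The partial derivative `∂ h / ∂ uᵢ` at `u`. -/
def partialDeriv {n : ℕ} (i : Fin n) (h : (Fin n → ℝ) → ℝ) (u : Fin n → ℝ) : ℝ :=
  fderiv ℝ h u (Pi.single i 1)

/-- The Christoffel symbol `Γᵏᵢⱼ` of the Levi-Civita connection of the metric with coefficient
matrix `g` on an open subset of `ℝⁿ`. -/
def christoffel {n : ℕ} (g : (Fin n → ℝ) → Matrix (Fin n) (Fin n) ℝ) (u : Fin n → ℝ)
    (k i j : Fin n) : ℝ :=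
  (1 / 2 : ℝ) * ∑ l, (g u)⁻¹ k l *
    (partialDeriv i (fun v => g v j l) u + partialDeriv j (fun v => g v i l) u
      - partialDeriv l (fun v => g v i j) u)

/-- The curve `σ`, restricted to the open set `I` of times, is a geodesic of the `n`-dimensional
Riemannian manifold `(M, Γ)`: it is smooth and in every smooth chart it satisfies
`c̈ᵏ + ∑ᵢⱼ Γᵏᵢⱼ(c) ċⁱ ċʲ = 0`. -/
structure IsGeodesicOn {E : Type*} [NormedAddCommGroup E] [NormedSpace ℝ E] {M : Set E} (n : ℕ)
    (Γ : M → E → E → ℝ) (σ : ℝ → M) (I : Set ℝ) : Prop where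
  smooth : ContDiffOn ℝ ∞ (fun t => (σ t : E)) I
  smooth_chart : ∀ χ : OpenPartialHomeomorph M (Fin n → ℝ), IsSmoothChart χ →
    ∀ t ∈ I, σ t ∈ χ.source → ContDiffAt ℝ ∞ (fun s => χ (σ s)) t
  equation : ∀ χ : OpenPartialHomeomorph M (Fin n → ℝ), IsSmoothChart χ →
    ∀ t ∈ I, σ t ∈ χ.source → ∀ k : Fin n,
      deriv (deriv fun s => χ (σ s) k) t
        + ∑ i, ∑ j, christoffel (metricInChart Γ χ) (χ (σ t)) k i j
            * deriv (fun s => χ (σ s) i) t * deriv (fun s => χ (σ s) j) t = 0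

/-! ### The affine Riemann surface, its metric and its vector field -/

/-- `a = 2 cos (2π/5)`. -/
def a : ℝ := 2 * Real.cos (2 * Real.pi / 5)

/-- `b = 2 cos (π/5)`. -/
def b : ℝ := 2 * Real.cos (Real.pi / 5)

/-- `f(ξ) = ξ⁸ (ξ - a)³ (ξ - b)⁹`. -/
def f (ξ : ℂ) : ℂ := ξ ^ 8 * (ξ - a) ^ 3 * (ξ - b) ^ 9

/-- The Schwarz-Christoffel constant `k = a / ∫₀ᵃ dξ / η`, where `η` is the positive tenth root of
`f(ξ) > 0` for `0 < ξ < a`. -/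
def k : ℝ := a / ∫ x in (0 : ℝ)..a, 1 / (x ^ 8 * (x - a) ^ 3 * (x - b) ^ 9) ^ (1 / 10 : ℝ)

/-- The affine Riemann surface `S = {η¹⁰ = f(ξ)}` in `ℂ²`, with points `p = (ξ, η)`. -/
def S : Set (ℂ × ℂ) := {p | p.2 ^ 10 = f p.1}

/-- `S_reg = S \ {(0,0), (a,0), (b,0)}`. -/
def Sreg : Set (ℂ × ℂ) := S \ {((0 : ℂ), (0 : ℂ)), ((a : ℂ), (0 : ℂ)), ((b : ℂ), (0 : ℂ))}

/-- The holomorphic vector field `X = (η / k) ∂/∂ξ + (f'(ξ) / (10 k η⁸)) ∂/∂η`. -/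
def X (p : Sreg) : ℂ × ℂ :=
  (1 / (k : ℂ) * p.1.2, 1 / (10 * (k : ℂ)) * (deriv f p.1.1 / p.1.2 ^ 8))

/-- The metric `Γ = (k / η) dξ ⊙ conj ((k / η) dξ)`, as a real bilinear form. -/
def Γ (p : Sreg) (v w : ℂ × ℂ) : ℝ :=
  (((k : ℂ) / p.1.2 * v.1) * conj ((k : ℂ) / p.1.2 * w.1)).re

/-- `φ` is on `D ⊆ ℂ` a complex time integral curve of `X`: `φ` is holomorphic and
`dφ/dz = X(φ)`. -/
def IsComplexTimeIntegralCurveOn (φ : ℂ → Sreg) (D : Set ℂ) : Prop :=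
  ∀ z ∈ D, HasDerivAt (fun w => (φ w : ℂ × ℂ)) (X (φ z)) z

/-- `μ` is on `J ⊆ ℝ` a real time integral curve of `X`: `dμ/ds = X(μ)`. -/
def IsRealTimeIntegralCurveOn (μ : ℝ → Sreg) (J : Set ℝ) : Prop :=
  ∀ s ∈ J, HasDerivAt (fun t => (μ t : ℂ × ℂ)) (X (μ s)) s

/-- `σ : I → S_reg` is a complex time reparametrization of the real time integral curve
`μ : J → S_reg` of `X`: there is a complex time integral curve `φ` of `X` on a connected open
`D ⊆ ℂ` containing `J` which extends `μ`, and `σ(t) = φ(z₀ + α t)` for some complex `z₀` and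
`α ≠ 0`. -/
def IsComplexTimeReparametrization (σ : ℝ → Sreg) (I : Set ℝ) (μ : ℝ → Sreg) (J : Set ℝ) : Prop :=
  ∃ (D : Set ℂ) (φ : ℂ → Sreg) (α z₀ : ℂ),
    IsOpen D ∧ IsConnected D ∧ IsComplexTimeIntegralCurveOn φ D ∧
    (∀ s ∈ J, (s : ℂ) ∈ D ∧ φ s = μ s) ∧ α ≠ 0 ∧
    ∀ t ∈ I, z₀ + α * t ∈ D ∧ σ t = φ (z₀ + α * t)

/-- `δ` is a local branch of the developing map of `S_reg` and it straightens `X`: it is a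
biholomorphic map of an open subset of `S_reg` onto an open subset of `ℂ`, of the form
`δ(ξ, η) = F(ξ)` with `F` a branch of `∫ k dξ / η`; its tangent map sends `X` to `∂/∂z`, and the
tangent map of its inverse sends `∂/∂z` to `X`. -/
def IsStraightening (δ : OpenPartialHomeomorph Sreg ℂ) : Prop :=
  (∃ F : ℂ → ℂ, ∀ q ∈ δ.source, δ q = F q.1.1 ∧
    HasDerivAt F ((k : ℂ) / q.1.2) q.1.1 ∧
    fderiv ℂ (fun p : ℂ × ℂ => F p.1) q.1 (X q) = 1) ∧
  IsComplexTimeIntegralCurveOn δ.symm δ.target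

end Icosahedron

end

namespace Icosahedron

open scoped Topology
open Set Filter MeasureTheory

/-! The form `k dξ / η` takes the value 1 on `X`, and `Γ` is its squared modulus. On `Sreg` the
coordinate `η` never vanishes, so the surface is locally the graph of a holomorphic branch `h` of
the tenth root of `f` (`exists_branch`). A primitive `F` of `k / h` has nonzero derivative, so the
inverse function theorem makes `F(ξ)` a chart, and this chart straightens `X`. Such an `F` also
pulls the Euclidean metric of `ℂ` back to `Γ` (`exists_flat_coordinate`). The curve `σ` has velocity
`α X(σ)`, so `F ∘ σ` has constant derivative `α` and is a straight line. In an arbitrary chart, the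
geodesic equation is the second derivative of this affine relation, rewritten with the Christoffel
symbols of a pulled-back metric (`geodesic_equation_of_pullback`). -/

/-! ### The constant `k` is nonzero -/

lemma a_pos : 0 < a := by
  have := Real.pi_pos
  exact mul_pos two_pos (Real.cos_pos_of_mem_Ioo ⟨by linarith, by linarith⟩)

lemma a_lt_b : a < b := by
  have := Real.pi_pos
  have h := Real.cos_lt_cos_of_nonneg_of_le_pi (x := Real.pi / 5) (y := 2 * Real.pi / 5)
    (by linarith) (by linarith) (by linarith)
  unfold a b
  linarith

/-- The integrand defining `k`, written as a product of powers with positive bases. -/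
lemma one_div_rpow_eq {x : ℝ} (hx : x ∈ Icc 0 a) :
    1 / (x ^ 8 * (x - a) ^ 3 * (x - b) ^ 9) ^ (1 / 10 : ℝ) =
      x ^ (-(4 / 5) : ℝ) * (a - x) ^ (-(3 / 10) : ℝ) * (b - x) ^ (-(9 / 10) : ℝ) := by
  have h0 : 0 ≤ x := hx.1
  have h1 : 0 ≤ a - x := sub_nonneg.2 hx.2
  have h2 : 0 ≤ b - x := by linarith [a_lt_b]
  have e : x ^ 8 * (x - a) ^ 3 * (x - b) ^ 9 = x ^ 8 * (a - x) ^ 3 * (b - x) ^ 9 := by ring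
  rw [e, Real.mul_rpow (by positivity) (by positivity), Real.mul_rpow (by positivity)
    (by positivity), ← Real.rpow_natCast x, ← Real.rpow_natCast (a - x),
    ← Real.rpow_natCast (b - x), ← Real.rpow_mul h0, ← Real.rpow_mul h1, ← Real.rpow_mul h2,
    Real.rpow_neg h0, Real.rpow_neg h1, Real.rpow_neg h2]
  norm_num
  ring

/-- The exponents -4/5 at `0` and -3/10 at `a` exceed -1, and the factor at `b` is continuous on
`[0, a]` since `a < b`. Splitting at `a / 2` isolates the two singularities. -/
lemma intervalIntegrable_one_div_rpow :
    IntervalIntegrable (fun x : ℝ => 1 / (x ^ 8 * (x - a) ^ 3 * (x - b) ^ 9) ^ (1 / 10 : ℝ))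
      volume 0 a := by
  have ha := a_pos
  have hab := a_lt_b
  have key : IntervalIntegrable (fun x : ℝ =>
      x ^ (-(4 / 5) : ℝ) * (a - x) ^ (-(3 / 10) : ℝ) * (b - x) ^ (-(9 / 10) : ℝ)) volume 0 a := by
    apply IntervalIntegrable.mul_continuousOn
    · apply IntervalIntegrable.trans (b := a / 2)
      · apply IntervalIntegrable.mul_continuousOn
        · exact intervalIntegral.intervalIntegrable_rpow' (by norm_num)
        · refine ContinuousOn.rpow_const (by fun_prop) fun x hx => Or.inl ?_
          rw [uIcc_of_le (by linarith)] at hx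
          linarith [hx.2]
      · apply IntervalIntegrable.continuousOn_mul
        · have h := (intervalIntegral.intervalIntegrable_rpow' (a := a / 2) (b := 0)
            (r := -(3 / 10)) (by norm_num)).comp_sub_left a
          convert! h using 1 <;> ring
        · refine ContinuousOn.rpow_const (by fun_prop) fun x hx => Or.inl ?_
          rw [uIcc_of_le (by linarith)] at hx
          linarith [hx.1]
    · refine ContinuousOn.rpow_const (by fun_prop) fun x hx => Or.inl ?_
      rw [uIcc_of_le ha.le] at hx
      linarith [hx.2]
  refine key.congr fun x hx => ?_
  rw [uIoc_of_le ha.le] at hx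
  exact (one_div_rpow_eq ⟨hx.1.le, hx.2⟩).symm

/-- Integrability matters: a divergent integral would be 0 by convention and give `k = 0`. -/
lemma k_pos : 0 < k := by
  refine div_pos a_pos (intervalIntegral.intervalIntegral_pos_of_pos_on
    intervalIntegrable_one_div_rpow (fun x hx => ?_) a_pos)
  rw [one_div_rpow_eq ⟨hx.1.le, hx.2.le⟩]
  have h0 : 0 < x := hx.1
  have h1 : 0 < a - x := sub_pos.2 hx.2
  have h2 : 0 < b - x := by linarith [a_lt_b]
  positivity

lemma k_ne_zero : (k : ℂ) ≠ 0 := Complex.ofReal_ne_zero.2 k_pos.ne'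

lemma snd_pow (p : Sreg) : p.1.2 ^ 10 = f p.1.1 := p.2.1

lemma snd_ne_zero (p : Sreg) : p.1.2 ≠ 0 := by
  obtain ⟨⟨ξ, η⟩, hS, hp⟩ := p
  rintro rfl
  have h1 : (0 : ℂ) ^ 10 = f ξ := hS
  rw [zero_pow (by norm_num), f, eq_comm, mul_eq_zero, mul_eq_zero, pow_eq_zero_iff (by norm_num),
    pow_eq_zero_iff (by norm_num), pow_eq_zero_iff (by norm_num), sub_eq_zero, sub_eq_zero] at h1
  rcases h1 with (h1 | h1) | h1 <;> simp [h1] at hp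

lemma mem_Sreg {ξ η : ℂ} (h : η ^ 10 = f ξ) (h0 : η ≠ 0) : (ξ, η) ∈ Sreg := by
  refine ⟨h, fun hp => h0 ?_⟩
  simp only [mem_insert_iff, mem_singleton_iff, Prod.mk.injEq] at hp
  tauto

lemma differentiable_f : Differentiable ℂ f := by
  unfold f
  fun_prop

/-! ### Geodesics of a metric pulled back from a Euclidean space -/

section Flat

variable {n : ℕ} {V : Type*} [NormedAddCommGroup V] [InnerProductSpace ℝ V]
  {c : (Fin n → ℝ) → V} {u : Fin n → ℝ} {g : (Fin n → ℝ) → Matrix (Fin n) (Fin n) ℝ}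

lemma partialDeriv_pullback (hc : ContDiffAt ℝ ∞ c u)
    (hg : ∀ᶠ v in 𝓝 u, ∀ i j, g v i j =
      inner ℝ (fderiv ℝ c v (Pi.single i 1)) (fderiv ℝ c v (Pi.single j 1))) (l i j : Fin n) :
    partialDeriv l (fun v => g v i j) u =
      inner ℝ (fderiv ℝ c u (Pi.single i 1))
        (fderiv ℝ (fderiv ℝ c) u (Pi.single l 1) (Pi.single j 1)) +
      inner ℝ (fderiv ℝ (fderiv ℝ c) u (Pi.single l 1) (Pi.single i 1))
        (fderiv ℝ c u (Pi.single j 1)) := by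
  have hd : DifferentiableAt ℝ (fderiv ℝ c) u :=
    (hc.fderiv_right (m := 1) (by norm_cast)).differentiableAt (by norm_num)
  have h1 (w : Fin n → ℝ) := hd.hasFDerivAt.clm_apply (hasFDerivAt_const w u)
  have h2 := (h1 (Pi.single i 1)).inner ℝ (h1 (Pi.single j 1))
  rw [partialDeriv, EventuallyEq.fderiv_eq (hg.mono fun v hv => hv i j), h2.fderiv]
  simp

/-- By symmetry of second derivatives, four of the six product-rule terms cancel and the other two
coincide, absorbing the factor 1/2. -/
lemma christoffel_pullback (hc : ContDiffAt ℝ ∞ c u)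
    (hg : ∀ᶠ v in 𝓝 u, ∀ i j, g v i j =
      inner ℝ (fderiv ℝ c v (Pi.single i 1)) (fderiv ℝ c v (Pi.single j 1))) (k i j : Fin n) :
    christoffel g u k i j = ∑ l, (g u)⁻¹ k l *
      inner ℝ (fderiv ℝ (fderiv ℝ c) u (Pi.single i 1) (Pi.single j 1))
        (fderiv ℝ c u (Pi.single l 1)) := by
  have hs : IsSymmSndFDerivAt ℝ c u := (hc.of_le (m := 2) (by norm_cast)).isSymmSndFDerivAt (by simp)
  rw [christoffel, Finset.mul_sum]
  refine Finset.sum_congr rfl fun l _ => ?_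
  rw [partialDeriv_pullback hc hg, partialDeriv_pullback hc hg, partialDeriv_pullback hc hg,
    hs (Pi.single j 1) (Pi.single i 1), hs (Pi.single l 1) (Pi.single i 1),
    hs (Pi.single l 1) (Pi.single j 1),
    real_inner_comm (fderiv ℝ (fderiv ℝ c) u (Pi.single i 1) (Pi.single l 1))]
  ring

/-- A vector `v` in the kernel of the Gram matrix satisfies `|Dc v|² = vᵀ g v = 0`. -/
lemma isUnit_det_pullback (hinj : Function.Injective (fderiv ℝ c u))
    (hg : ∀ i j, g u i j =
      inner ℝ (fderiv ℝ c u (Pi.single i 1)) (fderiv ℝ c u (Pi.single j 1))) :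
    IsUnit (g u).det := by
  rw [isUnit_iff_ne_zero]
  intro h0
  obtain ⟨v, hv0, hv⟩ := Matrix.exists_mulVec_eq_zero_iff.2 h0
  have hexp : fderiv ℝ c u v = ∑ i, v i • fderiv ℝ c u (Pi.single i 1) := by
    conv_lhs => rw [pi_eq_sum_univ' v]
    simp [map_sum]
  have h1 : inner ℝ (fderiv ℝ c u v) (fderiv ℝ c u v) = v ⬝ᵥ (g u).mulVec v := by
    rw [hexp]
    simp only [sum_inner, inner_sum, real_inner_smul_left, real_inner_smul_right, dotProduct,
      Matrix.mulVec, Finset.mul_sum, hg]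
    refine Finset.sum_congr rfl fun i _ => Finset.sum_congr rfl fun j _ => ?_
    rw [real_inner_comm]
    ring
  rw [hv, dotProduct_zero, inner_self_eq_zero] at h1
  exact hv0 (hinj (h1.trans (map_zero _).symm))

/-- A curve which an immersion `c` maps to a straight line satisfies the geodesic equation of the
metric pulled back from the Euclidean metric by `c`. -/
theorem geodesic_equation_of_pullback (hc : ContDiffAt ℝ ∞ c u)
    (hinj : Function.Injective (fderiv ℝ c u))
    (hg : ∀ᶠ v in 𝓝 u, ∀ i j, g v i j =
      inner ℝ (fderiv ℝ c v (Pi.single i 1)) (fderiv ℝ c v (Pi.single j 1)))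
    {y : ℝ → Fin n → ℝ} {t : ℝ} (hy : ContDiffAt ℝ ∞ y t) (hyu : y t = u) {w v₀ : V}
    (hcy : ∀ᶠ s in 𝓝 t, c (y s) = s • w + v₀) (k : Fin n) :
    deriv (deriv fun s => y s k) t
      + ∑ i, ∑ j, christoffel g u k i j
          * deriv (fun s => y s i) t * deriv (fun s => y s j) t = 0 := by
  subst hyu
  have hdet := isUnit_det_pullback hinj hg.self_of_nhds
  have hy1 : ∀ᶠ s in 𝓝 t, DifferentiableAt ℝ y s :=
    ((hy.of_le (m := 1) (by norm_cast)).eventually (by simp)).mono fun s hs => hs.differentiableAt (by simp)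
  have hc1 : ∀ᶠ s in 𝓝 t, DifferentiableAt ℝ c (y s) :=
    hy.continuousAt.eventually
      (((hc.of_le (m := 1) (by norm_cast)).eventually (by simp)).mono fun s hs => hs.differentiableAt (by simp))
  have hcomp (i : Fin n) : ∀ᶠ s in 𝓝 t, deriv (fun s => y s i) s = deriv y s i :=
    hy1.mono fun s hs => (hasDerivAt_pi.1 hs.hasDerivAt i).deriv
  have hy2 : DifferentiableAt ℝ (deriv y) t :=
    ((hy.fderiv_right (m := 1) (by norm_cast)).differentiableAt (by norm_num)).clm_apply
      (differentiableAt_const 1)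
  have hcomp2 : deriv (deriv fun s => y s k) t = deriv (deriv y) t k := by
    rw [EventuallyEq.deriv_eq (hcomp k), (hasDerivAt_pi.1 hy2.hasDerivAt k).deriv]
  have hd : DifferentiableAt ℝ (fderiv ℝ c) (y t) :=
    (hc.fderiv_right (m := 1) (by norm_cast)).differentiableAt (by norm_num)
  have hfirst : ∀ᶠ s in 𝓝 t, fderiv ℝ c (y s) (deriv y s) = w := by
    filter_upwards [hcy.eventually_nhds, hy1, hc1] with s h1 h2 h3
    have h4 := h3.hasFDerivAt.comp_hasDerivAt s h2.hasDerivAt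
    have h5 : HasDerivAt (fun s : ℝ => s • w + v₀) w s := by
      simpa using ((hasDerivAt_id s).smul_const w).add_const v₀
    exact h4.unique (h5.congr_of_eventuallyEq h1)
  have hsecond : fderiv ℝ (fderiv ℝ c) (y t) (deriv y t) (deriv y t)
      + fderiv ℝ c (y t) (deriv (deriv y) t) = 0 := by
    have h1 := (hd.hasFDerivAt.comp_hasDerivAt t
      hy1.self_of_nhds.hasDerivAt).clm_apply hy2.hasDerivAt
    exact h1.unique ((hasDerivAt_const t w).congr_of_eventuallyEq hfirst)
  have hexp (L : (Fin n → ℝ) →L[ℝ] V) (v : Fin n → ℝ) : L v = ∑ i, v i • L (Pi.single i 1) := by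
    conv_lhs => rw [pi_eq_sum_univ' v]
    simp [map_sum]
  have hB : fderiv ℝ (fderiv ℝ c) (y t) (deriv y t) (deriv y t) = ∑ i, ∑ j,
      (deriv y t i * deriv y t j) •
        fderiv ℝ (fderiv ℝ c) (y t) (Pi.single i 1) (Pi.single j 1) := by
    conv_lhs => rw [pi_eq_sum_univ' (deriv y t)]
    simp only [map_sum, map_smul, sum_apply, smul_apply,
      Finset.smul_sum, smul_smul]
    rw [Finset.sum_comm]
    exact Finset.sum_congr rfl fun i _ => Finset.sum_congr rfl fun j _ => by rw [mul_comm]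
  -- The Christoffel term is `g⁻¹` applied to the products `⟨D²c(ẏ, ẏ), ∂ₗc⟩`. By `hsecond` these
  -- equal `-⟨Dc ÿ, ∂ₗc⟩ = -(g ÿ)ₗ`, so the term is `-ÿ`.
  have hsum : ∑ i, ∑ j, christoffel g (y t) k i j
        * deriv (fun s => y s i) t * deriv (fun s => y s j) t =
      ∑ l, (g (y t))⁻¹ k l * inner ℝ (fderiv ℝ (fderiv ℝ c) (y t) (deriv y t) (deriv y t))
        (fderiv ℝ c (y t) (Pi.single l 1)) := by
    simp only [hB, sum_inner, real_inner_smul_left, christoffel_pullback hc hg, Finset.mul_sum,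
      Finset.sum_mul]
    simp only [(hcomp _).self_of_nhds]
    conv_rhs => rw [Finset.sum_comm]
    refine Finset.sum_congr rfl fun i _ => ?_
    rw [Finset.sum_comm]
    exact Finset.sum_congr rfl fun l _ => Finset.sum_congr rfl fun j _ => by ring
  have hinner (l : Fin n) : inner ℝ (fderiv ℝ c (y t) (deriv (deriv y) t))
      (fderiv ℝ c (y t) (Pi.single l 1)) = (g (y t)).mulVec (deriv (deriv y) t) l := by
    rw [hexp _ (deriv (deriv y) t)]
    simp only [sum_inner, real_inner_smul_left, Matrix.mulVec, dotProduct, hg.self_of_nhds]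
    exact Finset.sum_congr rfl fun i _ => by rw [real_inner_comm, mul_comm]
  have hinv : ∑ l, (g (y t))⁻¹ k l * (g (y t)).mulVec (deriv (deriv y) t) l
      = deriv (deriv y) t k := by
    change (g (y t))⁻¹.mulVec ((g (y t)).mulVec (deriv (deriv y) t)) k = _
    rw [Matrix.mulVec_mulVec, Matrix.nonsing_inv_mul _ hdet, Matrix.one_mulVec]
  rw [hsum, hcomp2, eq_neg_of_add_eq_zero_left hsecond]
  simp only [inner_neg_left, hinner, mul_neg, Finset.sum_neg_distrib, hinv, add_neg_cancel]

end Flat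

/-! ### Local branches and straightening charts -/

/-- Near a point of `Sreg` the surface is the graph of a holomorphic branch `h` of `f ^ (1 / 10)`,
and `k / h` has a primitive `F`. -/
lemma exists_branch (p : Sreg) : ∃ (U V : Set ℂ) (h F : ℂ → ℂ), IsOpen U ∧ IsOpen V ∧
    p.1.1 ∈ U ∧ p.1.2 ∈ V ∧ (∀ q : Sreg, q.1.2 ∈ V → q.1.2 = h q.1.1) ∧
    ∀ ξ ∈ U, h ξ ∈ V ∧ h ξ ^ 10 = f ξ ∧ h ξ ≠ 0 ∧
      HasDerivAt h (deriv f ξ / (10 * h ξ ^ 9)) ξ ∧ HasDerivAt F (k / h ξ) ξ := by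
  have hη := snd_ne_zero p
  have hstrict : HasStrictDerivAt (fun η : ℂ => η ^ 10) (10 * p.1.2 ^ 9) p.1.2 := by
    simpa using hasStrictDerivAt_pow 10 p.1.2
  let e := hstrict.hasStrictFDerivAt_equiv (by simpa using hη) |>.toOpenPartialHomeomorph
  have hpe : p.1.2 ∈ e.source := HasStrictFDerivAt.mem_toOpenPartialHomeomorph_source _
  have he (η : ℂ) : e η = η ^ 10 := rfl
  set W : Set ℂ := f ⁻¹' (e.target ∩ {0}ᶜ) with hW
  have hWo : IsOpen W :=
    (e.open_target.inter isOpen_compl_singleton).preimage differentiable_f.continuous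
  have hpW : p.1.1 ∈ W := by
    rw [hW, mem_preimage, ← snd_pow]
    exact ⟨e.map_source hpe, by simpa using hη⟩
  -- On a ball the holomorphic function `k / h` has a primitive.
  obtain ⟨r, hr, hrW⟩ := Metric.isOpen_iff.1 hWo _ hpW
  let h : ℂ → ℂ := fun ξ => e.symm (f ξ)
  have hpow (ξ) (hξ : ξ ∈ W) : h ξ ^ 10 = f ξ := e.right_inv hξ.1
  have hne (ξ) (hξ : ξ ∈ W) : h ξ ≠ 0 := by
    intro h0
    have h1 := hpow ξ hξ
    rw [h0, zero_pow (by norm_num)] at h1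
    exact hξ.2 h1.symm
  have hd (ξ) (hξ : ξ ∈ W) : HasDerivAt h (deriv f ξ / (10 * h ξ ^ 9)) ξ := by
    have h1 : HasDerivAt e (10 * h ξ ^ 9) (h ξ) := by
      rw [show (e : ℂ → ℂ) = fun η => η ^ 10 from rfl]
      simpa using hasDerivAt_pow 10 (h ξ)
    have h2 := e.hasDerivAt_symm hξ.1 (by simpa using hne ξ hξ) h1
    have h3 := h2.comp ξ (differentiable_f ξ).hasDerivAt
    convert! h3 using 1
    rw [div_eq_inv_mul]
  have hdiff : DifferentiableOn ℂ (fun ξ => (k : ℂ) / h ξ) (Metric.ball p.1.1 r) := fun ξ hξ =>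
    ((differentiableAt_const _).div (hd ξ (hrW hξ)).differentiableAt
      (hne ξ (hrW hξ))).differentiableWithinAt
  obtain ⟨F, hF⟩ := hdiff.isExactOn_ball
  refine ⟨Metric.ball p.1.1 r, e.source, h, F, Metric.isOpen_ball, e.open_source,
    Metric.mem_ball_self hr, hpe, fun q hq => ?_, fun ξ hξ => ⟨e.map_target (hrW hξ).1,
    hpow ξ (hrW hξ), hne ξ (hrW hξ), hd ξ (hrW hξ), hF ξ hξ⟩⟩
  change _ = e.symm (f q.1.1)
  rw [← snd_pow, ← he, e.left_inv hq]

theorem exists_straightening (p : Sreg) :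
    ∃ δ : OpenPartialHomeomorph Sreg ℂ, p ∈ δ.source ∧ IsStraightening δ := by
  classical
  obtain ⟨U, V, h, F, hU, hV, hpU, hpV, hgraph, hUV⟩ := exists_branch p
  have hk := k_ne_zero
  have hFd : DifferentiableOn ℂ F U := fun ξ hξ =>
    (hUV ξ hξ).2.2.2.2.differentiableAt.differentiableWithinAt
  have hstrict : HasStrictDerivAt F (k / h p.1.1) p.1.1 := by
    have h1 := (hFd.analyticAt (hU.mem_nhds hpU)).hasStrictDerivAt
    rwa [(hUV _ hpU).2.2.2.2.deriv] at h1
  let e₀ := hstrict.hasStrictFDerivAt_equiv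
    (div_ne_zero hk (hUV _ hpU).2.2.1) |>.toOpenPartialHomeomorph
  have hpe : p.1.1 ∈ e₀.source := HasStrictFDerivAt.mem_toOpenPartialHomeomorph_source _
  let e := e₀.restrOpen U hU
  have heU : e.source = e₀.source ∩ U := e₀.restrOpen_source U hU
  have hsymmU (z) (hz : z ∈ e.target) : e.symm z ∈ U := by
    have := e.map_target hz
    rw [heU] at this
    exact this.2
  have hmem (z) (hz : z ∈ e.target) : (e.symm z, h (e.symm z)) ∈ Sreg :=
    mem_Sreg (hUV _ (hsymmU z hz)).2.1 (hUV _ (hsymmU z hz)).2.2.1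
  -- The inverse lifts `F⁻¹` to the graph of `h`; the value `p` outside the target is arbitrary.
  let inv : ℂ → Sreg := fun z => if hz : z ∈ e.target then ⟨_, hmem z hz⟩ else p
  have hinv (z) (hz : z ∈ e.target) : (inv z : ℂ × ℂ) = (e.symm z, h (e.symm z)) := by
    simp [inv, hz]
  have hcont : Continuous fun q : Sreg => q.1 := continuous_subtype_val
  have hderiv (z) (hz : z ∈ e.target) :
      HasDerivAt (fun w => (inv w : ℂ × ℂ)) (X (inv z)) z := by
    have hξ := hUV _ (hsymmU z hz)
    have h0 := hξ.2.2.1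
    have h1 : HasDerivAt e.symm (k / h (e.symm z))⁻¹ z :=
      e.hasDerivAt_symm hz (div_ne_zero hk h0) hξ.2.2.2.2
    have h2 := h1.prodMk (hξ.2.2.2.1.comp z h1)
    have h3 := h2.congr_of_eventuallyEq
      (f₁ := fun w => (inv w : ℂ × ℂ)) (mem_of_superset (e.open_target.mem_nhds hz) hinv)
    have hX : X (inv z) = ((k / h (e.symm z))⁻¹,
        deriv f (e.symm z) / (10 * h (e.symm z) ^ 9) * (k / h (e.symm z))⁻¹) := by
      simp only [X, hinv z hz, Prod.mk.injEq]
      constructor <;> field_simp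
    rw [hX]
    exact h3
  let δ : OpenPartialHomeomorph Sreg ℂ :=
    { toFun := fun q => F q.1.1
      invFun := inv
      -- The condition on `η` selects one of the ten sheets over `ξ`.
      source := {q | q.1.1 ∈ e.source ∧ q.1.2 ∈ V}
      target := e.target
      map_source' := fun q hq => e.map_source hq.1
      map_target' := fun z hz => by
        simp only [mem_ofPred_eq, hinv z hz]
        exact ⟨e.map_target hz, (hUV _ (hsymmU z hz)).1⟩
      left_inv' := fun q hq => by
        have h1 : e.symm (F q.1.1) = q.1.1 := e.left_inv hq.1
        apply Subtype.ext
        rw [hinv (F q.1.1) (e.map_source hq.1), h1, ← hgraph q hq.2]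
      right_inv' := fun z hz => by
        simp only [hinv z hz]
        exact e.right_inv hz
      open_source := (e.open_source.preimage (continuous_fst.comp hcont)).inter
        (hV.preimage (continuous_snd.comp hcont))
      open_target := e.open_target
      continuousOn_toFun := e.continuousOn.comp (continuous_fst.comp hcont).continuousOn
        fun q hq => hq.1
      continuousOn_invFun := Topology.IsInducing.subtypeVal.continuousOn_iff.2 fun z hz =>
        (hderiv z hz).continuousAt.continuousWithinAt }
  refine ⟨δ, ⟨?_, hpV⟩, ⟨F, fun q hq => ?_⟩, hderiv⟩
  · rw [heU]
    exact ⟨hpe, hpU⟩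
  · have hqU : q.1.1 ∈ U := by
      have := hq.1
      rw [heU] at this
      exact this.2
    have hF : HasDerivAt F (k / q.1.2) q.1.1 := by
      rw [hgraph q hq.2]
      exact (hUV _ hqU).2.2.2.2
    refine ⟨rfl, hF, ?_⟩
    have h1 := hF.comp_hasFDerivAt q.1 (hasFDerivAt_fst (𝕜 := ℂ) (E := ℂ) (F := ℂ) (p := q.1))
    have h2 : fderiv ℂ (fun p : ℂ × ℂ => F p.1) q.1 = _ := h1.fderiv
    have hq0 := snd_ne_zero q
    rw [h2]
    simp only [smul_apply, ContinuousLinearMap.coe_fst', X, smul_eq_mul]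
    field_simp

lemma exists_primitive (p : Sreg) :
    ∃ F : ℂ → ℂ, ContDiffAt ℝ ∞ F p.1.1 ∧ ∀ᶠ q : Sreg in 𝓝 p, HasDerivAt F (k / q.1.2) q.1.1 := by
  obtain ⟨U, V, h, F, hU, hV, hpU, hpV, hgraph, hUV⟩ := exists_branch p
  refine ⟨F, ?_, ?_⟩
  · have hFd : DifferentiableOn ℂ F U := fun ξ hξ =>
      (hUV ξ hξ).2.2.2.2.differentiableAt.differentiableWithinAt
    exact (hFd.analyticAt (hU.mem_nhds hpU)).contDiffAt.restrict_scalars ℝ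
  · have h1 : ∀ᶠ q : Sreg in 𝓝 p, q.1.1 ∈ U :=
      (continuous_fst.comp continuous_subtype_val).continuousAt.eventually (hU.mem_nhds hpU)
    have h2 : ∀ᶠ q : Sreg in 𝓝 p, q.1.2 ∈ V :=
      (continuous_snd.comp continuous_subtype_val).continuousAt.eventually (hV.mem_nhds hpV)
    filter_upwards [h1, h2] with q hq1 hq2
    rw [hgraph q hq2]
    exact (hUV _ hq1).2.2.2.2

/-! ### Flat coordinates and the geodesic equation on `Sreg` -/

/-- A branch `F` of `∫ k dξ / η` read in a smooth chart of `Sreg` is a local isometry to `ℂ`. -/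
lemma exists_flat_coordinate {χ : OpenPartialHomeomorph Sreg (Fin 2 → ℝ)} (hχ : IsSmoothChart χ)
    {p : Sreg} (hp : p ∈ χ.source) :
    ∃ F : ℂ → ℂ, (∀ᶠ q : Sreg in 𝓝 p, HasDerivAt F (k / q.1.2) q.1.1) ∧
      ContDiffAt ℝ ∞ (fun u => F (χ.symm u).1.1) (χ p) ∧
      Function.Injective (fderiv ℝ (fun u => F (χ.symm u).1.1) (χ p)) ∧
      ∀ᶠ v in 𝓝 (χ p), ∀ i j, metricInChart Γ χ v i j =
        inner ℝ (fderiv ℝ (fun u => F (χ.symm u).1.1) v (Pi.single i 1))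
          (fderiv ℝ (fun u => F (χ.symm u).1.1) v (Pi.single j 1)) := by
  obtain ⟨F, hFs, hF⟩ := exists_primitive p
  have hu := χ.map_source hp
  have hΨ (v) (hv : v ∈ χ.target) : ContDiffAt ℝ ∞ (fun u => (χ.symm u : ℂ × ℂ)) v :=
    hχ.smooth.contDiffAt (χ.open_target.mem_nhds hv)
  have hfd : ∀ v ∈ χ.target, HasDerivAt F (k / (χ.symm v).1.2) (χ.symm v).1.1 → ∀ w,
      fderiv ℝ (fun u => F (χ.symm u).1.1) v w =
        k / (χ.symm v).1.2 * (fderiv ℝ (fun u => (χ.symm u : ℂ × ℂ)) v w).1 := by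
    intro v hv hFv w
    have h1 := (hΨ v hv).differentiableAt (by simp) |>.hasFDerivAt
    have h2 := (hFv.hasFDerivAt.restrictScalars ℝ).comp v h1.fst
    have h3 : fderiv ℝ (fun u => F (χ.symm u).1.1) v = _ := h2.fderiv
    rw [h3]
    simp [mul_comm]
  refine ⟨F, hF, ?_, ?_, ?_⟩
  · refine ContDiffAt.comp (g := F) (f := fun u => (χ.symm u).1.1) (χ p) ?_ (hΨ _ hu).fst
    rwa [χ.left_inv hp]
  · rw [injective_iff_map_eq_zero]
    intro w hw
    have hFp := hF.self_of_nhds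
    rw [← χ.left_inv hp] at hFp
    rw [hfd _ hu hFp, mul_eq_zero, or_iff_right (div_ne_zero k_ne_zero (snd_ne_zero _))] at hw
    have h1 := (hΨ _ hu).differentiableAt (by simp) |>.hasFDerivAt
    have h2 := ((differentiable_f _).hasDerivAt.hasFDerivAt.restrictScalars ℝ).comp (χ p) h1.fst
    have h3 := h1.snd.pow 10
    have h4 := h3.congr_of_eventuallyEq (Eventually.of_forall fun v => (snd_pow (χ.symm v)).symm)
    have h5 := DFunLike.congr_fun (h2.unique h4) w
    have hη := snd_ne_zero (χ.symm (χ p))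
    have h6 : (fderiv ℝ (fun u => (χ.symm u : ℂ × ℂ)) (χ p) w).2 = 0 := by
      simpa [hw, hη] using h5
    refine hχ.immersion _ hu ((Prod.ext hw h6 : _ = (0 : ℂ × ℂ)).trans (map_zero _).symm)
  · have h1 : ∀ᶠ v in 𝓝 (χ p), HasDerivAt F (k / (χ.symm v).1.2) (χ.symm v).1.1 := by
      have := (χ.continuousAt_symm hu).tendsto
      rw [χ.left_inv hp] at this
      exact this.eventually hF
    filter_upwards [h1, χ.open_target.mem_nhds hu] with v hFv hv i j
    rw [hfd v hv hFv, hfd v hv hFv, Complex.inner]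
    simp only [metricInChart, Matrix.of_apply, Γ]
    rw [← Complex.conj_re, map_mul, Complex.conj_conj, mul_comm]

/-- A `C^∞` map with injective derivative between spaces of the same finite dimension reflects
smoothness of continuous curves. -/
lemma contDiffAt_of_comp {E G H : Type*} [NormedAddCommGroup E] [NormedSpace ℝ E]
    [FiniteDimensional ℝ E] [NormedAddCommGroup G] [NormedSpace ℝ G] [FiniteDimensional ℝ G]
    [NormedAddCommGroup H] [NormedSpace ℝ H]
    (hdim : Module.finrank ℝ E = Module.finrank ℝ G) {c : E → G} {y : H → E} {t : H}
    (hc : ContDiffAt ℝ ∞ c (y t)) (hinj : Function.Injective (fderiv ℝ c (y t)))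
    (hy : ContinuousAt y t) (hcy : ContDiffAt ℝ ∞ (fun s => c (y s)) t) : ContDiffAt ℝ ∞ y t := by
  let L : E ≃L[ℝ] G := (LinearMap.linearEquivOfInjective
    (fderiv ℝ c (y t) : E →ₗ[ℝ] G) hinj hdim).toContinuousLinearEquiv
  have hL : HasFDerivAt c (L : E →L[ℝ] G) (y t) := by
    have h1 := (hc.differentiableAt (by simp)).hasFDerivAt
    convert! h1 using 1
  have h2 := hc.to_localInverse hL (by simp)
  have h3 : ∀ᶠ x in 𝓝 (y t), hc.localInverse hL (by simp) (c x) = x :=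
    (hc.hasStrictFDerivAt' hL (by simp)).eventually_left_inverse
  refine (h2.comp t hcy).congr_of_eventuallyEq ?_
  filter_upwards [hy.eventually h3] with s hs
  exact hs.symm

lemma isGeodesicOn_of_affine_developing {σ : ℝ → Sreg} {I : Set ℝ} (hI : IsOpen I)
    (hσ : ContDiffOn ℝ ∞ (fun t => (σ t : ℂ × ℂ)) I) {α : ℂ}
    (hσ' : ∀ t ∈ I, HasDerivAt (fun s => (σ s : ℂ × ℂ)) (α • X (σ t)) t) :
    IsGeodesicOn 2 Γ σ I := by
  have hcont (t) (ht : t ∈ I) : ContinuousAt σ t :=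
    Topology.IsInducing.subtypeVal.continuousAt_iff.2 (hσ' t ht).continuousAt
  have key (χ : OpenPartialHomeomorph Sreg (Fin 2 → ℝ)) (t : ℝ) (ht : t ∈ I)
      (hs : σ t ∈ χ.source) (F : ℂ → ℂ)
      (hF : ∀ᶠ q : Sreg in 𝓝 (σ t), HasDerivAt F (k / q.1.2) q.1.1) :
      ∃ v₀, ∀ᶠ s in 𝓝 t, F (χ.symm (χ (σ s))).1.1 = s • α + v₀ := by
    have h1 : ∀ᶠ s in 𝓝 t, HasDerivAt (fun s => F (σ s).1.1 - s • α) 0 s := by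
      filter_upwards [(hcont t ht).eventually hF, hI.mem_nhds ht] with s hFs hsI
      have h2 := (hFs.scomp s (hσ' s hsI).fst).sub ((hasDerivAt_id s).smul_const α)
      convert! h2 using 1
      have := snd_ne_zero (σ s)
      have := k_ne_zero
      simp only [X, Prod.smul_fst, smul_eq_mul, one_smul]
      field_simp
      simp
    obtain ⟨r, hr, hball⟩ := Metric.eventually_nhds_iff_ball.1 h1
    refine ⟨F (σ t).1.1 - t • α, ?_⟩
    filter_upwards [Metric.ball_mem_nhds t hr,
      (hcont t ht).eventually (χ.open_source.mem_nhds hs)] with s hsr hss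
    have h3 : F (σ s).1.1 - s • α = F (σ t).1.1 - t • α :=
      Metric.isOpen_ball.is_const_of_deriv_eq_zero (convex_ball t r).isPreconnected
        (fun x hx => (hball x hx).differentiableAt.differentiableWithinAt)
        (fun x hx => (hball x hx).deriv) hsr (Metric.mem_ball_self hr)
    rw [χ.left_inv hss, ← h3]
    abel
  -- `IsSmoothChart` gives smoothness of `χ.symm` only; that of `χ ∘ σ` comes from inverting the
  -- flat coordinate along the affine line.
  have hsm (χ : OpenPartialHomeomorph Sreg (Fin 2 → ℝ)) (hχ : IsSmoothChart χ) (t : ℝ)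
      (ht : t ∈ I) (hs : σ t ∈ χ.source) : ContDiffAt ℝ ∞ (fun s => χ (σ s)) t := by
    obtain ⟨F, hF, hc, hinj, -⟩ := exists_flat_coordinate hχ hs
    obtain ⟨v₀, hv₀⟩ := key χ t ht hs F hF
    refine contDiffAt_of_comp (by simp) hc hinj ((χ.continuousAt hs).comp (hcont t ht)) ?_
    refine ContDiffAt.congr_of_eventuallyEq ?_ hv₀
    fun_prop
  refine ⟨hσ, hsm, fun χ hχ t ht hs => ?_⟩
  obtain ⟨F, hF, hc, hinj, hg⟩ := exists_flat_coordinate hχ hs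
  obtain ⟨v₀, hv₀⟩ := key χ t ht hs F hF
  exact geodesic_equation_of_pullback hc hinj hg (hsm χ hχ t ht hs) rfl hv₀

end Icosahedron

theorem claim3p2 :
    (∀ p : Icosahedron.Sreg, ∃ δ : OpenPartialHomeomorph Icosahedron.Sreg ℂ,
      p ∈ δ.source ∧ Icosahedron.IsStraightening δ) ∧
    (∀ (μ : ℝ → Icosahedron.Sreg) (J : Set ℝ) (σ : ℝ → Icosahedron.Sreg) (I : Set ℝ),
      IsOpen J → IsConnected J → Icosahedron.IsRealTimeIntegralCurveOn μ J →
      IsOpen I → IsConnected I → Icosahedron.IsComplexTimeReparametrization σ I μ J →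
      Icosahedron.IsGeodesicOn 2 Icosahedron.Γ σ I) := by
  refine ⟨Icosahedron.exists_straightening, ?_⟩
  rintro μ J σ I - - - hI - ⟨D, φ, α, z₀, hD, -, hφ, -, -, hσ⟩
  have hlin (t : ℝ) : HasDerivAt (fun s : ℝ => z₀ + α * s) α t := by
    simpa using ((Complex.ofRealCLM.hasDerivAt (x := t)).const_mul α).const_add z₀
  have hdiff : DifferentiableOn ℂ (fun w => (φ w : ℂ × ℂ)) D := fun z hz =>
    (hφ z hz).differentiableAt.differentiableWithinAt
  refine Icosahedron.isGeodesicOn_of_affine_developing hI (α := α) ?_ fun t ht => ?_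
  · have h1 : ContDiffOn ℝ ∞ (fun w => (φ w : ℂ × ℂ)) D :=
      (hdiff.contDiffOn hD).restrict_scalars ℝ
    have h2 : ContDiff ℝ ∞ fun s : ℝ => z₀ + α * s :=
      contDiff_const.add (contDiff_const.mul Complex.ofRealCLM.contDiff)
    exact (h1.comp h2.contDiffOn fun t ht => (hσ t ht).1).congr
      fun t ht => congrArg Subtype.val (hσ t ht).2
  -- The chain rule gives the velocity `α X(σ)`.
  · have h1 := (hφ _ (hσ t ht).1).scomp t (hlin t)
    rw [← (hσ t ht).2] at h1
    refine h1.congr_of_eventuallyEq ?_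
    filter_upwards [hI.mem_nhds ht] with s hs
    exact congrArg Subtype.val (hσ s hs).2
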